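/- Let $\mathbb{X}=C(\mathbb{R}^d)$ with the topology of locally uniform convergence and its Borel $\sigma$-algebra. Let $X$ (the storm process) and $\Psi$ (the spatial intensity process) be non-negative stochastic processes on $\mathbb{R}^d$ with continuous sample paths, let $\mathbb{P}_X$ be the law of $X$ on $\mathbb{X}$, and let $\mu_Y>0$ be a constant. Let $N=\sum_{i=1}^\infty\delta_{(s_i,u_i,X_i)}$ be a Cox process on $\mathbb{R}^d\times(0,\infty]\times\mathbb{X}$ directed by the random measure $$\mathrm{d}\Lambda(s,u,f)=\mu_Y^{-1}\,\Psi(s)\,\mathrm{d}s\;u^{-2}\,\mathrm{d}u\;\mathrm{d}\mathbb{P}_X(f),$$ that is, conditionally on $\Lambda=\lambda$, $N$ is a Poisson process with directing measure $\lambda$. Let $K\subset\mathbb{R}^d$ be compact, and suppose that $\inf_{s\in K}\Psi(s)>0$ almost surely and that there is $r>0$ with $$\mathbb{P}_X\big(\{f\in\mathbb{X}: f(s)>0 \text{ for all } s\in B_r(o)\}\big)>0,$$ where $B_r(o)$ is the closed ball of radius $r$ centred at the origin. Then, for any enumeration of the points of $N$, almost surely there is a (random) $n\in\mathbb{N}$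 such that $$\inf_{t\in K}\ \max_{1\le i\le n} u_i\,X_i(t-s_i)>0 .$$ -/

import Mathlib

open MeasureTheory ProbabilityTheory Set
open scoped ENNReal NNReal

noncomputable section

namespace CoxExtremal

/-- The index space `ℝ^d` with its Euclidean norm. -/
abbrev Loc (d : ℕ) : Type := EuclideanSpace ℝ (Fin d)

/-- The space `C(ℝ^d)` of continuous paths, with the topology of locally uniform convergence
(the topology of the usual Fréchet metric). -/
abbrev PathSpace (d : ℕ) : Type := C(Loc d, ℝ)

/-- Path space carries its Borel σ-algebra. -/
instance instMeasurableSpacePathSpace (d : ℕ) : MeasurableSpace (PathSpace d) := borel _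

instance instBorelSpacePathSpace (d : ℕ) : BorelSpace (PathSpace d) := ⟨rfl⟩

/-- The space `(0, ∞]` of severities. -/
abbrev Severity : Type := Set.Ioi (0 : ℝ≥0∞)

/-- The state space `𝕊 = ℝ^d × (0, ∞] × C(ℝ^d)` of the points `(s, u, X)`. -/
abbrev State (d : ℕ) : Type := Loc d × Severity × PathSpace d

/-- The measure `u⁻² du` on `(0, ∞]`; it gives no mass to the point `∞`. -/
def severityMeasure : Measure Severity :=
  Measure.comap (Subtype.val : Severity → ℝ≥0∞)
    ((((volume : Measure ℝ).restrict (Set.Ioi 0)).withDensity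
      (fun u : ℝ => ENNReal.ofReal ((u ^ 2)⁻¹))).map ENNReal.ofReal)

/-- The measure `μ⁻¹ ψ(s) ds · u⁻² du · dP_X` on the state space. -/
def directingMeasure {d : ℕ} (μ : ℝ) (PX : Measure (PathSpace d)) (ψ : PathSpace d) :
    Measure (State d) :=
  ENNReal.ofReal μ⁻¹ •
    (((volume : Measure (Loc d)).withDensity (fun s => ENNReal.ofReal (ψ s))).prod
      (severityMeasure.prod PX))

/-- `N` is a Poisson process with directing measure `l`: counts of sets of finite directing
measure are Poisson distributed, and counts of disjoint sets are independent. -/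
structure IsPoissonProcess {Ω S : Type*} [MeasurableSpace Ω] [MeasurableSpace S]
    (N : Ω → Measure S) (l : Measure S) (P : Measure Ω) : Prop where
  measurable : Measurable N
  map_count : ∀ B : Set S, MeasurableSet B → l B < ∞ →
    P.map (fun ω => N ω B) =
      (poissonMeasure (l B).toNNReal).map (Nat.cast : ℕ → ℝ≥0∞)
  indep_count : ∀ (n : ℕ) (B : Fin n → Set S), (∀ i, MeasurableSet (B i)) →
    Pairwise (fun i j => Disjoint (B i) (B j)) →
    iIndepFun (fun i ω => N ω (B i)) P

/-- `N` is a Cox process directed by the random measure `L`: there is a regular conditional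
distribution `κ` of `N` given `L` such that, for almost every realization `l` of `L`, the
law `κ l` is that of a Poisson process with directing measure `l`. -/
structure IsCoxProcess {Ω S : Type*} [MeasurableSpace Ω] [MeasurableSpace S]
    (N L : Ω → Measure S) (P : Measure Ω) : Prop where
  measurable : Measurable N
  measurable_directing : Measurable L
  exists_condLaw : ∃ κ : Kernel (Measure S) (Measure S), IsMarkovKernel κ ∧
    P.map (fun ω => (L ω, N ω)) = (P.map L).compProd κ ∧
    ∀ᵐ l ∂(P.map L), IsPoissonProcess (fun m : Measure S => m) l (κ l)

/-- The contribution `u X(t - s) ∈ [0, ∞]` at site `t` of the storm `(s, u, X)`. -/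
def stormValue {d : ℕ} (p : State d) (t : Loc d) : ℝ≥0∞ :=
  (p.2.1 : ℝ≥0∞) * ENNReal.ofReal (p.2.2 (t - p.1))

/-- Almost surely, there is a finite `n` such that the maximum of the first `n` storms has
positive infimum over `K`. -/
def FinitelyManyStormsPositive {Ω : Type*} [MeasurableSpace Ω] {d : ℕ} (P : Measure Ω)
    (pt : ℕ → Ω → State d) (K : Set (Loc d)) : Prop :=
  ∀ᵐ ω ∂P, ∃ n : ℕ, 0 < ⨅ t ∈ K, ⨆ i ∈ Finset.range n, stormValue (pt i ω) t

end CoxExtremal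

end

namespace CoxExtremal

/-! The intensity `u⁻² du` has infinite mass near `0`, so storms of small severity abound. Cover `K`
by finitely many balls of radius `r / 2` centred in `K`. Given `Ψ`, storms centred in one such ball
with path positive on the closed `r`-ball have infinite directing mass: `Ψ` is positive at the
centre, hence has positive integral over the ball, and such paths have positive probability. A
Poisson process therefore hits this set almost surely, and integrating over the law of the directing
measure gives the same for the Cox process (`IsCoxProcess.ae_count_ne_zero`). One such storm bounds
the values on its ball away from `0` (`exists_pos_le_stormValue`), and finitely many balls suffice.
-/

lemma severityMeasure_Ioi {c : ℝ} (hc : 0 < c) :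
    severityMeasure {u : Severity | ENNReal.ofReal c < u} = ENNReal.ofReal c⁻¹ := by
  have himg : (Subtype.val '' {u : Severity | ENNReal.ofReal c < u}) =
      Ioi (ENNReal.ofReal c) := by
    ext u
    simp only [mem_image, mem_ofPred_eq, Subtype.exists, mem_Ioi]
    constructor
    · rintro ⟨a, ha, h, rfl⟩
      exact h
    · intro h
      exact ⟨u, (zero_le).trans_lt h, h, rfl⟩
  have hpre : ENNReal.ofReal ⁻¹' Ioi (ENNReal.ofReal c) = Ioi c := by
    ext u
    simp [ENNReal.ofReal_lt_ofReal_iff_of_nonneg hc.le]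
  rw [severityMeasure, (MeasurableEmbedding.subtype_coe measurableSet_Ioi).comap_apply, himg,
    Measure.map_apply ENNReal.measurable_ofReal measurableSet_Ioi, hpre,
    withDensity_apply _ measurableSet_Ioi, Measure.restrict_restrict measurableSet_Ioi,
    inter_eq_left.mpr (Ioi_subset_Ioi hc.le)]
  have hcongr : ∫⁻ u in Ioi c, ENNReal.ofReal ((u ^ 2)⁻¹) =
      ∫⁻ u in Ioi c, ENNReal.ofReal (u ^ (-2 : ℝ)) := by
    refine setLIntegral_congr_fun measurableSet_Ioi fun u hu => ?_
    have hu0 : 0 < u := hc.trans hu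
    rw [Real.rpow_neg hu0.le]
    norm_cast
  rw [hcongr, ← ofReal_integral_eq_lintegral_ofReal
    (integrableOn_Ioi_rpow_of_lt (by norm_num) hc), integral_Ioi_rpow_of_lt (by norm_num) hc]
  · congr 1
    norm_num [Real.rpow_neg_one]
  · filter_upwards [ae_restrict_mem measurableSet_Ioi] with u hu
    exact Real.rpow_nonneg (hc.trans hu).le _

/-- The severities exceeding `1 / (n + 1)`. -/
def severityAbove (n : ℕ) : Set Severity := {u | ENNReal.ofReal ((n : ℝ) + 1)⁻¹ < u}

lemma measurableSet_severityAbove (n : ℕ) : MeasurableSet (severityAbove n) :=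
  measurableSet_lt measurable_const measurable_subtype_coe

lemma severityMeasure_severityAbove (n : ℕ) :
    severityMeasure (severityAbove n) = n + 1 := by
  rw [severityAbove, severityMeasure_Ioi (by positivity), inv_inv,
    ENNReal.ofReal_add (by positivity) zero_le_one, ENNReal.ofReal_natCast, ENNReal.ofReal_one]

lemma iUnion_severityAbove : ⋃ n, severityAbove n = univ := by
  refine eq_univ_of_forall fun u => mem_iUnion.mpr ?_
  obtain ⟨n, hn⟩ := ENNReal.exists_inv_nat_lt (mem_Ioi.mp u.2).ne'
  refine ⟨n, lt_of_le_of_lt ?_ hn⟩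
  rw [ENNReal.ofReal_inv_of_pos (by positivity), ENNReal.inv_le_inv, ← ENNReal.ofReal_natCast]
  exact ENNReal.ofReal_le_ofReal (by linarith)

instance instSigmaFiniteSeverityMeasure : SigmaFinite severityMeasure :=
  ⟨⟨{ set := severityAbove
      set_mem := fun _ => trivial
      finite := fun n => by
        rw [severityMeasure_severityAbove]
        exact ENNReal.add_lt_top.mpr ⟨ENNReal.natCast_lt_top n, ENNReal.one_lt_top⟩
      spanning := iUnion_severityAbove }⟩⟩

lemma directingMeasure_prod {d : ℕ} (μ : ℝ) (PX : Measure (PathSpace d)) [SFinite PX]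
    (ψ : PathSpace d) {A : Set (Loc d)} (hA : MeasurableSet A) (n : ℕ) (F : Set (PathSpace d)) :
    directingMeasure μ PX ψ (A ×ˢ severityAbove n ×ˢ F) =
      ENNReal.ofReal μ⁻¹ * ((∫⁻ s in A, ENNReal.ofReal (ψ s)) * ((n + 1) * PX F)) := by
  rw [directingMeasure, Measure.smul_apply, Measure.prod_prod, Measure.prod_prod,
    severityMeasure_severityAbove, withDensity_apply _ hA, smul_eq_mul]

/-- By continuity, `ψ` is positive on a nonempty open subset of the ball, which has positive volume.
-/
lemma setLIntegral_ball_pos {d : ℕ} (ψ : PathSpace d) (x : Loc d) (hx : 0 < ψ x) {r : ℝ}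
    (hr : 0 < r) : 0 < ∫⁻ s in Metric.ball x r, ENNReal.ofReal (ψ s) := by
  have hmeas : Measurable fun s => ENNReal.ofReal (ψ s) :=
    ENNReal.measurable_ofReal.comp ψ.continuous.measurable
  rw [setLIntegral_pos_iff hmeas]
  have hopen : IsOpen ({s | 0 < ψ s} ∩ Metric.ball x r) :=
    (isOpen_lt continuous_const ψ.continuous).inter Metric.isOpen_ball
  refine (hopen.measure_pos volume ⟨x, hx, Metric.mem_ball_self hr⟩).trans_le
    (measure_mono fun s hs => ⟨?_, hs.2⟩)
  simpa using hs.1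

lemma setLIntegral_ball_lt_top {d : ℕ} (ψ : PathSpace d) (x : Loc d) (r : ℝ) :
    ∫⁻ s in Metric.ball x r, ENNReal.ofReal (ψ s) < ∞ := by
  have h := (ψ.continuous.continuousOn.integrableOn_compact (μ := volume)
    (isCompact_closedBall x r)).mono_set Metric.ball_subset_closedBall
  exact (lintegral_mono fun s => Real.ofReal_le_enorm _).trans_lt h.hasFiniteIntegral

/-- A Poisson process gives no mass to a set of finite directing measure `m` with
probability `exp (-m)`. -/
lemma IsPoissonProcess.measure_count_eq_zero {Ω S : Type*} [MeasurableSpace Ω]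
    [MeasurableSpace S] {N : Ω → Measure S} {l : Measure S} {P : Measure Ω}
    (h : IsPoissonProcess N l P) {B : Set S} (hB : MeasurableSet B) (hl : l B < ∞) :
    P {ω | N ω B = 0} = ENNReal.ofReal (Real.exp (-(l B).toReal)) := by
  have hmeas : Measurable fun ω => N ω B := (Measure.measurable_coe hB).comp h.measurable
  have h0 : (Nat.cast : ℕ → ℝ≥0∞) ⁻¹' {0} = {0} := by ext; simp
  have := congrArg (fun m : Measure ℝ≥0∞ => m {0}) (h.map_count B hB hl)
  rw [Measure.map_apply hmeas (measurableSet_singleton 0),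
    Measure.map_apply measurable_from_nat (measurableSet_singleton 0), h0,
    poissonMeasure_singleton] at this
  simp only [pow_zero, mul_one, Nat.factorial_zero, Nat.cast_one, div_one] at this
  exact this

/-- A Poisson process charges almost surely every set exhausted from inside by sets of finite,
unbounded directing measure. -/
lemma IsPoissonProcess.ae_count_ne_zero {Ω S : Type*} [MeasurableSpace Ω]
    [MeasurableSpace S] {N : Ω → Measure S} {l : Measure S} {P : Measure Ω}
    (h : IsPoissonProcess N l P) {A : Set S} {B : ℕ → Set S} (hB : ∀ n, MeasurableSet (B n))
    (hBA : ∀ n, B n ⊆ A) (hfin : ∀ n, l (B n) < ∞) (hsup : ⨆ n, l (B n) = ∞) :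
    ∀ᵐ ω ∂P, N ω A ≠ 0 := by
  rw [ae_iff]
  simp only [ne_eq, not_not]
  refine nonpos_iff_eq_zero.mp (le_of_forall_gt fun ε hε => ?_)
  have hlim : Filter.Tendsto (fun x : ℝ => ENNReal.ofReal (Real.exp (-x))) Filter.atTop
      (nhds 0) := by
    rw [← ENNReal.ofReal_zero]
    exact (ENNReal.continuous_ofReal.tendsto 0).comp Real.tendsto_exp_neg_atTop_nhds_zero
  -- Once `l (B n) ≥ M`, the void probability `exp (-l (B n))` is below `ε`.
  obtain ⟨M, hM⟩ := Filter.eventually_atTop.mp (hlim.eventually_lt_const hε)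
  obtain ⟨n, hn⟩ := lt_iSup_iff.mp (hsup ▸ ENNReal.ofReal_lt_top (r := M))
  have hMn : M ≤ (l (B n)).toReal := (ENNReal.ofReal_le_iff_le_toReal (hfin n).ne).mp hn.le
  calc P {ω | N ω A = 0} ≤ P {ω | N ω (B n) = 0} :=
        measure_mono fun ω (hω : N ω A = 0) => measure_mono_null (hBA n) hω
    _ = _ := h.measure_count_eq_zero (hB n) (hfin n)
    _ < ε := hM _ hMn

/-- Disintegrate the joint law of `(L, N)` along `L`: for almost every realization `l` the Poisson
case applies to `κ l`. The sets `B n` must not depend on `ω`. -/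
lemma IsCoxProcess.ae_count_ne_zero {Ω S : Type*} [MeasurableSpace Ω] [MeasurableSpace S]
    {N L : Ω → Measure S} {P : Measure Ω} [IsProbabilityMeasure P] (h : IsCoxProcess N L P)
    {A : Set S} {B : ℕ → Set S} (hA : MeasurableSet A) (hB : ∀ n, MeasurableSet (B n))
    (hBA : ∀ n, B n ⊆ A) (hfin : ∀ᵐ ω ∂P, ∀ n, L ω (B n) < ∞)
    (hsup : ∀ᵐ ω ∂P, ⨆ n, L ω (B n) = ∞) :
    ∀ᵐ ω ∂P, N ω A ≠ 0 := by
  obtain ⟨κ, hκ, hmap, hpois⟩ := h.exists_condLaw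
  have hL := h.measurable_directing
  have hB' n : Measurable fun l : Measure S => l (B n) := Measure.measurable_coe (hB n)
  have : IsProbabilityMeasure (P.map L) := Measure.isProbabilityMeasure_map hL.aemeasurable
  have hfin' : ∀ᵐ l ∂(P.map L), ∀ n, l (B n) < ∞ := by
    refine (ae_map_iff hL.aemeasurable ?_).mpr hfin
    rw [ofPred_forall]
    exact MeasurableSet.iInter fun n => measurableSet_lt (hB' n) measurable_const
  have hsup' : ∀ᵐ l ∂(P.map L), ⨆ n, l (B n) = ∞ :=
    (ae_map_iff hL.aemeasurable
      (measurableSet_eq_fun (Measurable.iSup hB') measurable_const)).mpr hsup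
  have hE : MeasurableSet {p : Measure S × Measure S | p.2 A ≠ 0} :=
    (measurableSet_eq_fun ((Measure.measurable_coe hA).comp measurable_snd)
      measurable_const).compl
  have key : ∀ᵐ p ∂((P.map L).compProd κ), p.2 A ≠ 0 := by
    rw [Measure.ae_compProd_iff hE]
    filter_upwards [hpois, hfin', hsup'] with l h1 h2 h3
    exact h1.ae_count_ne_zero hB hBA h2 h3
  rw [← hmap] at key
  exact ae_of_ae_map (hL.prodMk h.measurable).aemeasurable key

lemma exists_mem_of_sum_dirac_ne_zero {S : Type*} [MeasurableSpace S] {p : ℕ → S} {A : Set S}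
    (hA : MeasurableSet A) (h : Measure.sum (fun i => Measure.dirac (p i)) A ≠ 0) :
    ∃ i, p i ∈ A := by
  by_contra! hp
  refine h ?_
  rw [Measure.sum_apply _ hA, ENNReal.tsum_eq_zero]
  intro i
  simp [Measure.dirac_apply' _ hA, hp i]

/-- Under a storm centred close to `x` whose path is positive on a ball, all sites close to `x`
receive values bounded away from `0`. -/
lemma exists_pos_le_stormValue {d : ℕ} {p : State d} {x : Loc d} {r : ℝ}
    (hs : p.1 ∈ Metric.ball x (r / 2)) (hf : MapsTo p.2.2 (Metric.closedBall 0 r) (Ioi 0)) :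
    ∃ c : ℝ≥0∞, 0 < c ∧ ∀ t ∈ Metric.ball x (r / 2), c ≤ stormValue p t := by
  have hr : 0 < r := by linarith [Metric.pos_of_mem_ball hs]
  obtain ⟨y, hy, hmin⟩ := (isCompact_closedBall (0 : Loc d) r).exists_isMinOn
    ⟨0, Metric.mem_closedBall_self hr.le⟩ p.2.2.continuous.continuousOn
  refine ⟨(p.2.1 : ℝ≥0∞) * ENNReal.ofReal (p.2.2 y),
    ENNReal.mul_pos (mem_Ioi.mp p.2.1.2).ne' (ENNReal.ofReal_pos.mpr (hf hy)).ne', ?_⟩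
  intro t ht
  refine mul_le_mul_right (ENNReal.ofReal_le_ofReal (hmin ?_)) _
  -- Both `t` and the storm centre lie within `r / 2` of `x`, so `t - p.1` has norm at most `r`.
  rw [mem_closedBall_zero_iff, ← dist_eq_norm]
  rw [Metric.mem_ball] at hs ht
  linarith [dist_triangle_right t p.1 x]

lemma exists_pos_iInf_iSup_stormValue {d : ℕ} {p : ℕ → State d} {K : Set (Loc d)} {r : ℝ}
    {T : Set (Loc d)} (hT : T.Finite) (hcov : K ⊆ ⋃ x ∈ T, Metric.ball x (r / 2))
    (h : ∀ x ∈ T, ∃ i, (p i).1 ∈ Metric.ball x (r / 2) ∧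
      MapsTo (p i).2.2 (Metric.closedBall 0 r) (Ioi 0)) :
    ∃ n : ℕ, 0 < ⨅ t ∈ K, ⨆ i ∈ Finset.range n, stormValue (p i) t := by
  have h' : ∀ x ∈ T, ∃ i, ∃ c : ℝ≥0∞, 0 < c ∧
      ∀ t ∈ Metric.ball x (r / 2), c ≤ stormValue (p i) t := fun x hx => by
    obtain ⟨i, hi⟩ := h x hx
    exact ⟨i, exists_pos_le_stormValue hi.1 hi.2⟩
  choose! i c hc hle using h'
  obtain ⟨n, hn⟩ := (hT.image i).bddAbove
  -- `n` bounds the chosen indices inclusively, hence `n + 1`. For empty `T` the infimum is `∞`,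
  -- still positive.
  refine ⟨n + 1, lt_of_lt_of_le (b := hT.toFinset.inf c) ?_ (le_iInf₂ fun t ht => ?_)⟩
  · rw [Finset.lt_inf_iff ENNReal.zero_lt_top]
    exact fun x hx => hc x (hT.mem_toFinset.mp hx)
  · obtain ⟨x, hx, htx⟩ := mem_iUnion₂.mp (hcov ht)
    calc hT.toFinset.inf c ≤ c x := Finset.inf_le (hT.mem_toFinset.mpr hx)
      _ ≤ stormValue (p (i x)) t := hle x hx t htx
      _ ≤ _ := le_iSup₂_of_le (i x) (Finset.mem_range.mpr
          (Nat.lt_succ_of_le (hn (mem_image_of_mem i hx)))) le_rfl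

end CoxExtremal

theorem mainTheorem6
    {Ω Ω' : Type*} [MeasurableSpace Ω] [MeasurableSpace Ω']
    (P : Measure Ω) [IsProbabilityMeasure P] (Q : Measure Ω') [IsProbabilityMeasure Q]
    (d : ℕ)
    -- the storm process, non-negative with continuous paths
    (X : Ω' → CoxExtremal.PathSpace d) (hX : Measurable X) (hX0 : ∀ ω t, 0 ≤ X ω t)
    -- the spatial intensity process, non-negative with continuous paths
    (Ψ : Ω → CoxExtremal.PathSpace d) (hΨ : Measurable Ψ) (hΨ0 : ∀ ω s, 0 ≤ Ψ ω s)
    -- the scaling constant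
    (μY : ℝ) (hμY : 0 < μY)
    -- the points `(s_i, u_i, X_i)` of the Cox process
    (pt : ℕ → Ω → CoxExtremal.State d)
    (hN : CoxExtremal.IsCoxProcess
      (fun ω => Measure.sum (fun i => Measure.dirac (pt i ω)))
      (fun ω => CoxExtremal.directingMeasure μY (Q.map X) (Ψ ω)) P)
    (K : Set (CoxExtremal.Loc d)) (hK : IsCompact K)
    (hΨK : ∀ᵐ ω ∂P, 0 < ⨅ s ∈ K, ENNReal.ofReal (Ψ ω s))
    (hsupp : ∃ r : ℝ, 0 < r ∧
      0 < (Q.map X) {f | Metric.closedBall 0 r ⊆ {s | 0 < f s}}) :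
    CoxExtremal.FinitelyManyStormsPositive P pt K := by
  obtain ⟨r, hr, hF⟩ := hsupp
  set F : Set (CoxExtremal.PathSpace d) := {f | MapsTo f (Metric.closedBall 0 r) (Ioi 0)}
  have hFpos : 0 < (Q.map X) F := hF
  have hFmeas : MeasurableSet F :=
    (ContinuousMap.isOpen_setOfPred_mapsTo (isCompact_closedBall _ _) isOpen_Ioi).measurableSet
  have : IsProbabilityMeasure (Q.map X) := Measure.isProbabilityMeasure_map hX.aemeasurable
  obtain ⟨T, hTK, hT, hcov⟩ := hK.finite_cover_balls (half_pos hr)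
  have hpos : ∀ᵐ ω ∂P, ∀ x ∈ K, 0 < Ψ ω x := by
    filter_upwards [hΨK] with ω hω x hx
    exact ENNReal.ofReal_pos.mp (hω.trans_le (iInf₂_le x hx))
  have hmem : ∀ x ∈ T, ∀ᵐ ω ∂P, ∃ i, pt i ω ∈ Metric.ball x (r / 2) ×ˢ univ ×ˢ F := by
    intro x hx
    have hA : MeasurableSet (Metric.ball x (r / 2) ×ˢ (univ : Set CoxExtremal.Severity) ×ˢ F) :=
      measurableSet_ball.prod (MeasurableSet.univ.prod hFmeas)
    have key := hN.ae_count_ne_zero hA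
      (B := fun n => Metric.ball x (r / 2) ×ˢ CoxExtremal.severityAbove n ×ˢ F)
      (fun n => measurableSet_ball.prod
        ((CoxExtremal.measurableSet_severityAbove n).prod hFmeas))
      (fun n => prod_mono_right (prod_mono_left (subset_univ _))) ?_ ?_
    · filter_upwards [key] with ω hω
      exact CoxExtremal.exists_mem_of_sum_dirac_ne_zero hA hω
    · refine Filter.Eventually.of_forall fun ω n => ?_
      rw [CoxExtremal.directingMeasure_prod _ _ _ measurableSet_ball]
      exact ENNReal.mul_lt_top ENNReal.ofReal_lt_top
        (ENNReal.mul_lt_top (CoxExtremal.setLIntegral_ball_lt_top _ _ _)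
          (ENNReal.mul_lt_top (by finiteness) (measure_lt_top _ _)))
    · filter_upwards [hpos] with ω hω
      -- Only the severity factor `n + 1` varies, with supremum `∞`; the other factors are nonzero,
      -- which excludes `0 * ∞ = 0`.
      simp_rw [CoxExtremal.directingMeasure_prod _ _ _ measurableSet_ball, ← ENNReal.mul_iSup,
        ← ENNReal.iSup_mul, ← ENNReal.iSup_add, ENNReal.iSup_natCast, top_add]
      rw [ENNReal.top_mul hFpos.ne', ENNReal.mul_top
        (CoxExtremal.setLIntegral_ball_pos _ x (hω x (hTK hx)) (half_pos hr)).ne',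
        ENNReal.mul_top (ENNReal.ofReal_pos.mpr (inv_pos.mpr hμY)).ne']
  -- The cover is deterministic and finite, so the exceptional null sets can be united.
  filter_upwards [(ae_ball_iff hT.countable).mpr hmem] with ω hω
  refine CoxExtremal.exists_pos_iInf_iSup_stormValue hT hcov fun x hx => ?_
  obtain ⟨i, hi⟩ := hω x hx
  exact ⟨i, hi.1, hi.2.2⟩
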